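/- Let $K=SO(2,\mathbb C)=\{k(z)=\mathrm{diag}(z,z^{-1}) : z\in\mathbb C^\times\}$. For $n\in\mathbb N_0$ let $\mathfrak g(n)=\mathbb C[x]H_n\oplus\mathbb C[x]X_n\oplus\mathbb C[x]Y_n$ be the Lie algebra over $\mathbb C[x]$ with $[H_n,X_n]=2X_n$, $[H_n,Y_n]=-2Y_n$, $[X_n,Y_n]=x^nH_n$, on which $K$ acts $\mathbb C[x]$-linearly with $H_n,X_n,Y_n$ of weights $0,2,-2$ (weight $w$ means that $k(z)$ acts as $z^w$). For $m,n\in\mathbb N_0$ and $k\in\mathbb Z$ let $$\psi^{1,k,1}:\mathbb C[x,x^{-1}]\otimes_{\mathbb C[x]}\mathfrak g(m)\to\mathbb C[x,x^{-1}]\otimes_{\mathbb C[x]}\mathfrak g(n)$$ be the $K$-equivariant morphism of Lie algebras over $\mathbb C[x,x^{-1}]$ given by $H_m\mapsto H_n$, $X_m\mapsto x^kX_n$, $Y_m\mapsto x^{m-n-k}Y_n$. On $\mathbb P^1_{\mathbb C}$ with homogeneous coordinates $[z_1;z_2]$ put $U_i=\{z_i\neq0\}$, and let $x=z_2/z_1$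 be the coordinate on $U_1\cap U_2=\mathbb C^\times$. Let $\mathcal E=(\mathfrak g(m),\mathfrak g(n),\psi^{1,k,1})$ be the $K$-equivariant sheaf of $\mathcal O_{\mathbb P^1}$-modules ($K$ acting trivially on $\mathbb P^1$) glued from the free sheaf with basis $H_m,X_m,Y_m$ on $U_1$ and the free sheaf with basis $H_n,X_n,Y_n$ on $U_2$ by the matrix of $\psi^{1,k,1}$ on $U_1\cap U_2$, that is, by $H_m=H_n$, $X_m=x^kX_n$, $Y_m=x^{m-n-k}Y_n$. (Only the structure of $K$-equivariant vector bundle is considered here, not the Lie brackets.) Then $\mathcal E$ is an algebraic $K$-equivariant vector bundle of rank $3$ on $\mathbb P^1_{\mathbb C}$, and there is an isomorphism of $K$-equivariant vector bundles $$\mathcal E\;\cong\;\mathcal O_{\mathbb P^1}(0)\oplus\mathcal O_{\mathbb P^1}(-k)\oplus\mathcal O_{\mathbb P^1}(k+n-m),$$ where $K$ acts on the three summands with weights $0$, $2$ and $-2$ respectively; under it the three summands are exactly the isotypic pieces of $\mathcal E$ of weights $0$, $2$ and $-2$. -/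

import Mathlib

open CategoryTheory CategoryTheory.Limits TopologicalSpace Opposite
open scoped Polynomial LaurentPolynomial TensorProduct

noncomputable section

namespace HCFamily

/-! ## The group `SO(2, ℂ)` and the families `𝔤(n)` over the affine line -/

/-- `SO(2, ℂ)`, realised as the group of matrices `k(z) = diag(z, z⁻¹)`, `z ∈ ℂˣ`. -/
def SO2 : Subgroup (Matrix.SpecialLinearGroup (Fin 2) ℂ) where
  carrier := {g | g 0 1 = 0 ∧ g 1 0 = 0}
  one_mem' := by simp
  mul_mem' := by
    rintro a b ⟨ha, ha'⟩ ⟨hb, hb'⟩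
    simp [Matrix.mul_apply, Fin.sum_univ_two, ha, ha', hb, hb']
  inv_mem' := by
    rintro a ⟨ha, ha'⟩
    simp [Matrix.SpecialLinearGroup.coe_inv, Matrix.adjugate_fin_two, ha, ha']

lemma SO2.diag_mul (g : SO2) : g.1 0 0 * g.1 1 1 = 1 := by
  have h := g.1.det_coe
  rw [Matrix.det_fin_two] at h
  rw [g.2.1] at h
  simpa using h

/-- The isomorphism `SO(2, ℂ) → ℂˣ`, `k(z) ↦ z`. -/
def SO2.param : SO2 →* ℂˣ where
  toFun g := ⟨g.1 0 0, g.1 1 1, SO2.diag_mul g, by rw [mul_comm]; exact SO2.diag_mul g⟩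
  map_one' := by ext; simp
  map_mul' a b := by
    ext
    simp [Matrix.mul_apply, Fin.sum_univ_two, a.2.1]

/-- The character of `SO(2, ℂ)` of weight `w`, that is `k(z) ↦ z ^ w`. -/
def SO2.char (w : ℤ) : SO2 →* ℂ where
  toFun g := ((SO2.param g ^ w : ℂˣ) : ℂ)
  map_one' := by simp
  map_mul' a b := by simp [mul_zpow]

/-- Names of the three basis sections. -/
inductive Idx : Type
  | H | X | Y
  deriving DecidableEq

instance : Fintype Idx := ⟨{Idx.H, Idx.X, Idx.Y}, fun i => by cases i <;> simp⟩

/-- The weights of `SO(2, ℂ)` on the basis sections: `0` on `H`, `2` on `X`, `-2` on `Y`. -/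
def Idx.weight : Idx → ℤ
  | .H => 0
  | .X => 2
  | .Y => -2

/-- The free `ℂ[x]`-module of global sections of the family `𝔤(n)`;
`a` stands for `a H • H_n + a X • X_n + a Y • Y_n`. -/
def Fam (_n : ℕ) : Type := Idx → ℂ[X]

namespace Fam

variable (n : ℕ)

instance : AddCommGroup (Fam n) := inferInstanceAs (AddCommGroup (Idx → ℂ[X]))
instance : Module ℂ[X] (Fam n) := inferInstanceAs (Module ℂ[X] (Idx → ℂ[X]))

variable {n} in
@[ext] lemma ext {a b : Fam n} (hH : a .H = b .H) (hX : a .X = b .X) (hY : a .Y = b .Y) :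
    a = b := by
  funext i; cases i <;> assumption

variable {n} in
@[simp] lemma add_apply (a b : Fam n) (i : Idx) : (a + b) i = a i + b i := rfl
variable {n} in
@[simp] lemma smul_apply (r : ℂ[X]) (a : Fam n) (i : Idx) : (r • a) i = r * a i := rfl
variable {n} in
@[simp] lemma zero_apply (i : Idx) : (0 : Fam n) i = 0 := rfl

/-- The basis `H_n, X_n, Y_n`. -/
def basis : Module.Basis Idx ℂ[X] (Fam n) := Pi.basisFun ℂ[X] Idx

lemma basis_apply (i j : Idx) : basis n i j = if j = i then 1 else 0 := by
  have : basis n i = (Pi.single i (1 : ℂ[X]) : Idx → ℂ[X]) := by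
    unfold basis; exact Pi.basisFun_apply _ _ i
  rw [this, Pi.single_apply]

/-- The `ℂ[x]`-bilinear bracket with
`[H_n, X_n] = 2 X_n`, `[H_n, Y_n] = -2 Y_n`, `[X_n, Y_n] = xⁿ H_n`. -/
instance : Bracket (Fam n) (Fam n) where
  bracket a b := fun i => match i with
    | .H => (Polynomial.X : ℂ[X]) ^ n * (a .X * b .Y - a .Y * b .X)
    | .X => 2 * (a .H * b .X - a .X * b .H)
    | .Y => -2 * (a .H * b .Y - a .Y * b .H)

variable {n} in
lemma lie_H (a b : Fam n) :
    ⁅a, b⁆ .H = (Polynomial.X : ℂ[X]) ^ n * (a .X * b .Y - a .Y * b .X) := rfl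
variable {n} in
lemma lie_X (a b : Fam n) : ⁅a, b⁆ .X = 2 * (a .H * b .X - a .X * b .H) := rfl
variable {n} in
lemma lie_Y (a b : Fam n) : ⁅a, b⁆ .Y = -2 * (a .H * b .Y - a .Y * b .H) := rfl

instance : LieRing (Fam n) where
  add_lie a b c := by ext1 <;> simp only [lie_H, lie_X, lie_Y, add_apply] <;> ring
  lie_add a b c := by ext1 <;> simp only [lie_H, lie_X, lie_Y, add_apply] <;> ring
  lie_self a := by ext1 <;> simp only [lie_H, lie_X, lie_Y, zero_apply] <;> ring
  leibniz_lie a b c := by ext1 <;> simp only [lie_H, lie_X, lie_Y, add_apply] <;> ring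

instance : LieAlgebra ℂ[X] (Fam n) where
  lie_smul r a b := by ext1 <;> simp only [lie_H, lie_X, lie_Y, smul_apply] <;> ring

lemma lie_basis_HX : ⁅basis n .H, basis n .X⁆ = (2 : ℂ[X]) • basis n .X := by
  ext1 <;> simp [lie_H, lie_X, lie_Y, basis_apply]
lemma lie_basis_HY : ⁅basis n .H, basis n .Y⁆ = (-2 : ℂ[X]) • basis n .Y := by
  ext1 <;> simp [lie_H, lie_X, lie_Y, basis_apply]
lemma lie_basis_XY :
    ⁅basis n .X, basis n .Y⁆ = (Polynomial.X ^ n : ℂ[X]) • basis n .H := by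
  ext1 <;> simp [lie_H, lie_X, lie_Y, basis_apply]

/-- The `ℂ[x]`-linear action of `SO(2, ℂ)` on `𝔤(n)`, for which `H_n`, `X_n`, `Y_n` have
weights `0`, `2`, `-2`. -/
def act : Representation ℂ[X] SO2 (Fam n) where
  toFun g :=
    { toFun := fun a i => Polynomial.C (SO2.char i.weight g) * a i
      map_add' := fun a b => funext fun i => mul_add _ _ _
      map_smul' := fun r a => funext fun i => mul_left_comm _ _ _ }
  map_one' := by
    refine LinearMap.ext fun a => funext fun i => ?_
    change Polynomial.C (SO2.char i.weight 1) * a i = a i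
    rw [map_one, map_one, one_mul]
  map_mul' g h := by
    refine LinearMap.ext fun a => funext fun i => ?_
    change Polynomial.C (SO2.char i.weight (g * h)) * a i =
      Polynomial.C (SO2.char i.weight g) * (Polynomial.C (SO2.char i.weight h) * a i)
    rw [map_mul, map_mul, mul_assoc]

/-- The restriction `ℂ[x, x⁻¹] ⊗ 𝔤(n)` of `𝔤(n)` to `ℂˣ`, a Lie algebra over `ℂ[x, x⁻¹]`. -/
def Loc : Type := ℂ[T;T⁻¹] ⊗[ℂ[X]] Fam n

instance : LieRing (Loc n) := inferInstanceAs (LieRing (ℂ[T;T⁻¹] ⊗[ℂ[X]] Fam n))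
instance : Module ℂ[T;T⁻¹] (Loc n) := inferInstanceAs (Module ℂ[T;T⁻¹] (ℂ[T;T⁻¹] ⊗[ℂ[X]] Fam n))
instance : LieAlgebra ℂ[T;T⁻¹] (Loc n) :=
  inferInstanceAs (LieAlgebra ℂ[T;T⁻¹] (ℂ[T;T⁻¹] ⊗[ℂ[X]] Fam n))

/-- The element `f ⊗ a` of `ℂ[x, x⁻¹] ⊗ 𝔤(n)`. -/
def Loc.tmul (f : ℂ[T;T⁻¹]) (a : Fam n) : Loc n := f ⊗ₜ[ℂ[X]] a

lemma Loc.smul_tmul (r f : ℂ[T;T⁻¹]) (a : Fam n) : r • Loc.tmul n f a = Loc.tmul n (r * f) a :=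
  TensorProduct.smul_tmul' r f a

lemma Loc.lie_tmul (f g : ℂ[T;T⁻¹]) (a b : Fam n) :
    ⁅Loc.tmul n f a, Loc.tmul n g b⁆ = Loc.tmul n (f * g) ⁅a, b⁆ :=
  LieAlgebra.ExtendScalars.bracket_tmul _ _ _ _ f g a b

lemma Loc.tmul_smul (r : ℂ[X]) (a : Fam n) :
    Loc.tmul n 1 (r • a) = algebraMap ℂ[X] ℂ[T;T⁻¹] r • Loc.tmul n 1 a := by
  rw [Loc.smul_tmul, mul_one]
  refine (TensorProduct.tmul_smul r (1 : ℂ[T;T⁻¹]) a).trans ?_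
  refine (TensorProduct.smul_tmul' r (1 : ℂ[T;T⁻¹]) a).trans ?_
  rw [Algebra.smul_def, mul_one]
  rfl

/-- The basis `1 ⊗ H_n, 1 ⊗ X_n, 1 ⊗ Y_n` of the restriction of `𝔤(n)` to `ℂˣ`. -/
def locBasis : Module.Basis Idx ℂ[T;T⁻¹] (Loc n) := (basis n).baseChange ℂ[T;T⁻¹]

lemma locBasis_apply (i : Idx) : locBasis n i = Loc.tmul n 1 (basis n i) :=
  Module.Basis.baseChange_apply _ (basis n) i

/-- The action of `SO(2, ℂ)` on the restriction of `𝔤(n)` to `ℂˣ`. -/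
def locAct (g : SO2) : Loc n →ₗ[ℂ[T;T⁻¹]] Loc n := (act n g).baseChange ℂ[T;T⁻¹]

lemma locAct_tmul (g : SO2) (f : ℂ[T;T⁻¹]) (a : Fam n) :
    locAct n g (Loc.tmul n f a) = Loc.tmul n f (act n g a) := rfl

/-- The coefficients of the morphism `ψ^{c,k,+1}` in the bases `locBasis`. -/
def psiCoeff (m n : ℕ) (c : ℂˣ) (k : ℤ) : Idx → ℂ[T;T⁻¹]
  | .H => 1
  | .X => LaurentPolynomial.C (c : ℂ) * LaurentPolynomial.T k
  | .Y => LaurentPolynomial.C ((c⁻¹ : ℂˣ) : ℂ) * LaurentPolynomial.T ((m : ℤ) - n - k)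

/-- The `ℂ[x, x⁻¹]`-linear map with
`1 ⊗ H_m ↦ 1 ⊗ H_n`, `1 ⊗ X_m ↦ c x^k ⊗ X_n`, `1 ⊗ Y_m ↦ c⁻¹ x^{m-n-k} ⊗ Y_n`. -/
def psiLinear (m n : ℕ) (c : ℂˣ) (k : ℤ) : Loc m →ₗ[ℂ[T;T⁻¹]] Loc n :=
  (locBasis m).constr ℂ[T;T⁻¹] fun i => Loc.tmul n (psiCoeff m n c k i) (basis n i)

lemma psiLinear_locBasis (m n : ℕ) (c : ℂˣ) (k : ℤ) (i : Idx) :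
    psiLinear m n c k (locBasis m i) = psiCoeff m n c k i • locBasis n i := by
  rw [psiLinear, Module.Basis.constr_basis, locBasis_apply, Loc.smul_tmul, mul_one]

lemma lie_locBasis (n : ℕ) (i j : Idx) :
    ⁅locBasis n i, locBasis n j⁆ = Loc.tmul n 1 ⁅basis n i, basis n j⁆ := by
  rw [locBasis_apply, locBasis_apply, Loc.lie_tmul, mul_one]

lemma smul_locBasis (n : ℕ) (r : ℂ[X]) (i : Idx) :
    Loc.tmul n 1 (r • basis n i) = algebraMap ℂ[X] ℂ[T;T⁻¹] r • locBasis n i := by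
  rw [locBasis_apply, Loc.tmul_smul]

lemma lie_locBasis_HX (n : ℕ) :
    ⁅locBasis n .H, locBasis n .X⁆ = (2 : ℂ[T;T⁻¹]) • locBasis n .X := by
  rw [lie_locBasis, lie_basis_HX, smul_locBasis, map_ofNat]
lemma lie_locBasis_HY (n : ℕ) :
    ⁅locBasis n .H, locBasis n .Y⁆ = (-2 : ℂ[T;T⁻¹]) • locBasis n .Y := by
  rw [lie_locBasis, lie_basis_HY, smul_locBasis, map_neg, map_ofNat]
lemma lie_locBasis_XY (n : ℕ) :
    ⁅locBasis n .X, locBasis n .Y⁆ =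
      (LaurentPolynomial.T (n : ℤ) : ℂ[T;T⁻¹]) • locBasis n .H := by
  rw [lie_locBasis, lie_basis_XY, smul_locBasis, LaurentPolynomial.algebraMap_eq_toLaurent,
    Polynomial.toLaurent_X_pow]

lemma psiCoeff_mul (m n : ℕ) (c : ℂˣ) (k : ℤ) :
    psiCoeff m n c k .X * psiCoeff m n c k .Y * LaurentPolynomial.T (n : ℤ) =
      LaurentPolynomial.T (m : ℤ) := by
  have h : (LaurentPolynomial.C (c : ℂ) : ℂ[T;T⁻¹]) *
      LaurentPolynomial.C ((c⁻¹ : ℂˣ) : ℂ) = 1 := by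
    rw [← map_mul, Units.mul_inv, map_one]
  simp only [psiCoeff]
  rw [mul_mul_mul_comm, h, one_mul, ← LaurentPolynomial.T_add, ← LaurentPolynomial.T_add]
  congr 1
  ring

lemma psiLinear_lie_basis (m n : ℕ) (c : ℂˣ) (k : ℤ) (i j : Idx) :
    psiLinear m n c k ⁅locBasis m i, locBasis m j⁆ =
      ⁅psiLinear m n c k (locBasis m i), psiLinear m n c k (locBasis m j)⁆ := by
  have hHX : psiLinear m n c k ⁅locBasis m .H, locBasis m .X⁆ =
      ⁅psiLinear m n c k (locBasis m .H), psiLinear m n c k (locBasis m .X)⁆ := by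
    simp only [lie_locBasis_HX, map_smul, psiLinear_locBasis, lie_smul, psiCoeff, one_smul]
    rw [smul_comm]
  have hHY : psiLinear m n c k ⁅locBasis m .H, locBasis m .Y⁆ =
      ⁅psiLinear m n c k (locBasis m .H), psiLinear m n c k (locBasis m .Y)⁆ := by
    simp only [lie_locBasis_HY, map_smul, psiLinear_locBasis, lie_smul, psiCoeff, one_smul]
    rw [smul_comm]
  have hXY : psiLinear m n c k ⁅locBasis m .X, locBasis m .Y⁆ =
      ⁅psiLinear m n c k (locBasis m .X), psiLinear m n c k (locBasis m .Y)⁆ := by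
    simp only [lie_locBasis_XY, map_smul, psiLinear_locBasis, lie_smul, smul_lie, smul_smul]
    rw [← psiCoeff_mul m n c k]
    congr 1
    simp only [psiCoeff, mul_one]
    ring
  have hs : ∀ i, psiLinear m n c k ⁅locBasis m i, locBasis m i⁆ =
      ⁅psiLinear m n c k (locBasis m i), psiLinear m n c k (locBasis m i)⁆ := fun i => by
    rw [lie_self, lie_self, map_zero]
  have hn : ∀ i j, psiLinear m n c k ⁅locBasis m i, locBasis m j⁆ =
      ⁅psiLinear m n c k (locBasis m i), psiLinear m n c k (locBasis m j)⁆ →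
      psiLinear m n c k ⁅locBasis m j, locBasis m i⁆ =
      ⁅psiLinear m n c k (locBasis m j), psiLinear m n c k (locBasis m i)⁆ := fun i j h => by
    rw [← lie_skew (locBasis m j), ← lie_skew (psiLinear m n c k (locBasis m j)), map_neg, h]
  match i, j with
  | .H, .H => exact hs _
  | .H, .X => exact hHX
  | .H, .Y => exact hHY
  | .X, .H => exact hn _ _ hHX
  | .X, .X => exact hs _
  | .X, .Y => exact hXY
  | .Y, .H => exact hn _ _ hHY
  | .Y, .X => exact hn _ _ hXY
  | .Y, .Y => exact hs _

/-- The morphism `ψ^{c,k,+1}` of Lie algebras from `𝔤(m)|_{ℂˣ}` to `𝔤(n)|_{ℂˣ}`. -/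
def psi (m n : ℕ) (c : ℂˣ) (k : ℤ) : Loc m →ₗ⁅ℂ[T;T⁻¹]⁆ Loc n where
  __ := psiLinear m n c k
  map_lie' := by
    intro a b
    change psiLinear m n c k ⁅a, b⁆ = ⁅psiLinear m n c k a, psiLinear m n c k b⁆
    have ha := (locBasis m).mem_span a
    have hb := (locBasis m).mem_span b
    induction ha using Submodule.span_induction with
    | mem a h =>
      obtain ⟨i, rfl⟩ := h
      induction hb using Submodule.span_induction with
      | mem b h => obtain ⟨j, rfl⟩ := h; exact psiLinear_lie_basis m n c k i j
      | zero => simp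
      | add x y _ _ hx hy => simp only [lie_add, map_add, hx, hy]
      | smul r x _ hx => simp only [lie_smul, map_smul, hx]
    | zero => simp
    | add x y _ _ hx hy => simp only [add_lie, map_add, hx, hy]
    | smul r x _ hx => simp only [smul_lie, map_smul, hx]

lemma psi_locBasis (m n : ℕ) (c : ℂˣ) (k : ℤ) (i : Idx) :
    psi m n c k (locBasis m i) = psiCoeff m n c k i • locBasis n i :=
  psiLinear_locBasis m n c k i

lemma locAct_locBasis (g : SO2) (i : Idx) :
    locAct n g (locBasis n i) = LaurentPolynomial.C (SO2.char i.weight g) • locBasis n i := by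
  have h : act n g (basis n i) = Polynomial.C (SO2.char i.weight g) • basis n i := by
    funext j
    change Polynomial.C (SO2.char j.weight g) * basis n i j =
      Polynomial.C (SO2.char i.weight g) * basis n i j
    rw [basis_apply]
    split_ifs with hj
    · rw [hj]
    · simp
  rw [← Polynomial.toLaurent_C, ← LaurentPolynomial.algebraMap_eq_toLaurent, ← smul_locBasis, ← h,
    locBasis_apply, locAct_tmul]

/-- `ψ^{c,k,+1}` commutes with the actions of `SO(2, ℂ)`. -/
lemma psi_locAct (m n : ℕ) (c : ℂˣ) (k : ℤ) (g : SO2) (a : Loc m) :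
    psi m n c k (locAct m g a) = locAct n g (psi m n c k a) := by
  have ha := (locBasis m).mem_span a
  induction ha using Submodule.span_induction with
  | mem a h =>
    obtain ⟨i, rfl⟩ := h
    simp only [locAct_locBasis, psi_locBasis, map_smul]
    rw [smul_comm]
  | zero => simp only [map_zero]
  | add x y _ _ hx hy => simp only [map_add, hx, hy]
  | smul r x _ hx => simp only [map_smul, hx]

end Fam

/-! ## The projective line with its Zariski topology and regular functions -/

/-- The points `[z₁; z₂]` of `ℙ¹`; the homogeneous coordinates `z₁, z₂` are indexed by
`0, 1 : Fin 2`. -/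
def Pt : Type := Projectivization ℂ (Fin 2 → ℂ)

/-- The vectors of homogeneous coordinates of a point. -/
def Rep (p : Pt) : Type := {v : Fin 2 → ℂ // ∃ hv : v ≠ 0, Projectivization.mk ℂ v hv = p}

/-- A chosen vector of homogeneous coordinates. -/
def Pt.rep (p : Pt) : Rep p := ⟨Projectivization.rep p, Projectivization.rep_nonzero p,
  Projectivization.mk_rep p⟩

lemma Rep.eq_smul {p : Pt} (v w : Rep p) : ∃ c : ℂˣ, c • w.1 = v.1 := by
  obtain ⟨v, hv, rfl⟩ := v
  obtain ⟨w, hw, h⟩ := w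
  exact (Projectivization.mk_eq_mk_iff ℂ v w hv hw).1 h.symm

/-- The Zariski topology, generated by the sets where a homogeneous polynomial does not vanish. -/
instance : TopologicalSpace Pt :=
  TopologicalSpace.generateFrom
    {U | ∃ (d : ℕ) (f : MvPolynomial (Fin 2) ℂ), f.IsHomogeneous d ∧
      U = {p : Pt | ∀ v : Rep p, MvPolynomial.eval v.1 f ≠ 0}}

/-- The projective line as a topological space. -/
abbrev P1 : TopCat.{0} := TopCat.of Pt

/-- The standard open sets `U_1 = {z₁ ≠ 0}` (`j = 0`) and `U_2 = {z₂ ≠ 0}` (`j = 1`). -/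
def chart (j : Fin 2) : Opens P1 where
  carrier := {p : Pt | ∀ v : Rep p, v.1 j ≠ 0}
  is_open' := TopologicalSpace.isOpen_generateFrom_of_mem
    ⟨1, MvPolynomial.X j, MvPolynomial.isHomogeneous_X ℂ j, by simp⟩

lemma exists_mem_chart (p : P1) : ∃ j, p ∈ chart j := by
  obtain ⟨w, hw, hwp⟩ := Pt.rep p
  obtain ⟨j, hj⟩ := Function.ne_iff.1 hw
  refine ⟨j, fun v h0 => hj ?_⟩
  obtain ⟨c, hc⟩ := Rep.eq_smul ⟨w, hw, hwp⟩ v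
  have := congrFun hc j
  simp only [Pi.smul_apply, h0, smul_zero] at this
  exact this.symm

/-- The functions that are, on all of `U`, a quotient `g / h` of homogeneous polynomials of the same
degree, `h` having no zero on `U`. -/
def ratioPrelocal : TopCat.PrelocalPredicate (fun _ : P1 => ℂ) where
  pred {U} f := ∃ (d : ℕ) (g h : MvPolynomial (Fin 2) ℂ), g.IsHomogeneous d ∧ h.IsHomogeneous d ∧
    ∀ (p : U) (v : Rep p.1), MvPolynomial.eval v.1 h ≠ 0 ∧
      f p = MvPolynomial.eval v.1 g / MvPolynomial.eval v.1 h
  res := by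
    rintro U V i f ⟨d, g, h, hg, hh, H⟩
    exact ⟨d, g, h, hg, hh, fun p v => H ⟨p.1, i.le p.2⟩ v⟩

/-- Regular functions: locally quotients of homogeneous polynomials of the same degree. -/
def isRegular : TopCat.LocalPredicate (fun _ : P1 => ℂ) := ratioPrelocal.sheafify

lemma isRegular_const (U : Opens P1) (c : ℂ) : isRegular.pred (fun _ : U => c) := by
  refine TopCat.PrelocalPredicate.sheafifyOf ?_
  exact ⟨0, MvPolynomial.C c, 1, MvPolynomial.isHomogeneous_C _ c,
    MvPolynomial.isHomogeneous_one _ _, fun p v => by simp⟩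

lemma isRegular_add {U : Opens P1} {f g : U → ℂ} (hf : isRegular.pred f) (hg : isRegular.pred g) :
    isRegular.pred (fun p => f p + g p) := by
  refine TopCat.PrelocalPredicate.sheafify_inductionOn₂' ratioPrelocal ratioPrelocal ratioPrelocal
    (fun {_} a b => a + b) ?_ hf hg
  rintro U V a b ⟨d, g, h, hg, hh, H⟩ ⟨d', g', h', hg', hh', H'⟩
  refine ⟨d + d', g * h' + h * g', h * h', (hg.mul hh').add (hh.mul hg'), hh.mul hh',
    fun p v => ?_⟩
  obtain ⟨h1, e1⟩ := H ⟨p, p.2.1⟩ v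
  obtain ⟨h2, e2⟩ := H' ⟨p, p.2.2⟩ v
  refine ⟨by simpa using ⟨h1, h2⟩, ?_⟩
  simp only [e1, e2, map_add, map_mul]
  exact div_add_div _ _ h1 h2

lemma isRegular_mul {U : Opens P1} {f g : U → ℂ} (hf : isRegular.pred f) (hg : isRegular.pred g) :
    isRegular.pred (fun p => f p * g p) := by
  refine TopCat.PrelocalPredicate.sheafify_inductionOn₂' ratioPrelocal ratioPrelocal ratioPrelocal
    (fun {_} a b => a * b) ?_ hf hg
  rintro U V a b ⟨d, g, h, hg, hh, H⟩ ⟨d', g', h', hg', hh', H'⟩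
  refine ⟨d + d', g * g', h * h', hg.mul hg', hh.mul hh', fun p v => ?_⟩
  obtain ⟨h1, e1⟩ := H ⟨p, p.2.1⟩ v
  obtain ⟨h2, e2⟩ := H' ⟨p, p.2.2⟩ v
  refine ⟨by simpa using ⟨h1, h2⟩, ?_⟩
  simp only [e1, e2, map_mul]
  exact div_mul_div_comm _ _ _ _

/-- The ring of regular functions on `U`. -/
def regularSubring (U : Opens P1) : Subring (U → ℂ) where
  carrier := {f | isRegular.pred f}
  zero_mem' := isRegular_const U 0
  one_mem' := isRegular_const U 1
  add_mem' hf hg := isRegular_add hf hg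
  mul_mem' hf hg := isRegular_mul hf hg
  neg_mem' {f} hf := by
    have := isRegular_mul (isRegular_const U (-1)) hf
    simp only [neg_mul, one_mul] at this
    exact this

/-- The presheaf of rings of regular functions. -/
def regularPresheaf : TopCat.Presheaf RingCat.{0} P1 where
  obj U := RingCat.of (regularSubring U.unop)
  map i := RingCat.ofHom
    { toFun := fun f => ⟨fun p => f.1 ⟨p.1, i.unop.le p.2⟩, isRegular.res i.unop f.1 f.2⟩
      map_zero' := rfl
      map_add' := fun _ _ => rfl
      map_one' := rfl
      map_mul' := fun _ _ => rfl }

/-- The structure sheaf of `ℙ¹`, the sheaf of rings of regular functions. -/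
def structureSheaf : Sheaf (Opens.grothendieckTopology P1) RingCat.{0} :=
  ⟨regularPresheaf, (TopCat.Presheaf.isSheaf_iff_isSheaf_comp (forget RingCat) _).mpr
    (TopCat.Presheaf.isSheaf_of_iso
      (NatIso.ofComponents (fun _ => Iso.refl _) (fun _ => rfl) :
        TopCat.subpresheafToTypes isRegular.toPrelocalPredicate ≅
          regularPresheaf ⋙ forget RingCat)
      (TopCat.subpresheafToTypes.isSheaf isRegular))⟩

/-! ## Sheaves of modules given by sections of a family of vector spaces -/

section Sections

variable (T : P1 → Type) [∀ p, AddCommGroup (T p)] [∀ p, Module ℂ (T p)]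

/-- A class of sections of a family `T` of vector spaces over `ℙ¹` which is local and closed under
sums and under multiplication by regular functions. -/
structure SectionClass extends TopCat.LocalPredicate T where
  zero : ∀ U : Opens P1, pred (fun _ : U => 0)
  add : ∀ {U : Opens P1} {s t : ∀ p : U, T p}, pred s → pred t → pred (fun p => s p + t p)
  smul : ∀ {U : Opens P1} {f : U → ℂ} {s : ∀ p : U, T p}, isRegular.pred f → pred s →
    pred (fun p => f p • s p)

variable {T} (S : SectionClass T)

/-- The group of sections over `U`. -/
def SectionClass.sections (U : Opens P1) : AddSubgroup (∀ p : U, T p) where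
  carrier := {s | S.pred s}
  zero_mem' := S.zero U
  add_mem' := S.add
  neg_mem' {s} hs := by
    have := S.smul (isRegular_const U (-1)) hs
    simp only [neg_smul, one_smul] at this
    exact this

instance (U : Opens P1) : Module (regularSubring U) (S.sections U) where
  smul f s := ⟨fun p => f.1 p • s.1 p, S.smul f.2 s.2⟩
  one_smul s := Subtype.ext (funext fun p => one_smul ℂ (s.1 p))
  mul_smul f g s := Subtype.ext (funext fun p => mul_smul (f.1 p) (g.1 p) (s.1 p))
  smul_zero f := Subtype.ext (funext fun p => smul_zero (f.1 p))
  smul_add f s t := Subtype.ext (funext fun p => smul_add (f.1 p) (s.1 p) (t.1 p))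
  add_smul f g s := Subtype.ext (funext fun p => add_smul (f.1 p) (g.1 p) (s.1 p))
  zero_smul s := Subtype.ext (funext fun p => zero_smul ℂ (s.1 p))

/-- The presheaf of abelian groups of sections. -/
def SectionClass.presheaf : (Opens P1)ᵒᵖ ⥤ Ab.{0} where
  obj U := AddCommGrpCat.of (S.sections U.unop)
  map i := AddCommGrpCat.ofHom
    { toFun := fun s => ⟨fun p => s.1 ⟨p.1, i.unop.le p.2⟩, S.res i.unop s.1 s.2⟩
      map_zero' := rfl
      map_add' := fun _ _ => rfl }

instance (U : (Opens P1)ᵒᵖ) : Module (structureSheaf.obj.obj U) (S.presheaf.obj U) :=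
  inferInstanceAs (Module (regularSubring U.unop) (S.sections U.unop))

/-- The sheaf of modules over the structure sheaf of `ℙ¹` whose sections over `U` are the sections
in the class `S`. -/
def SectionClass.sheaf : SheafOfModules.{0} structureSheaf where
  val := PresheafOfModules.ofPresheaf S.presheaf (fun _ _ _ _ _ => rfl)
  isSheaf := (TopCat.Presheaf.isSheaf_iff_isSheaf_comp (forget Ab.{0}) S.presheaf).mpr
    (TopCat.Presheaf.isSheaf_of_iso
      (NatIso.ofComponents (fun _ => Iso.refl _) (fun _ => rfl) :
        TopCat.subpresheafToTypes S.toPrelocalPredicate ≅ S.presheaf ⋙ forget Ab.{0})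
      (TopCat.subpresheafToTypes.isSheaf S.toLocalPredicate))

/-- The endomorphism of `S.sheaf` given by linear maps of the vector spaces `T p` preserving `S`. -/
def SectionClass.endo (φ : ∀ p, T p →ₗ[ℂ] T p)
    (hφ : ∀ {U : Opens P1} {s : ∀ p : U, T p}, S.pred s → S.pred (fun p => φ p.1 (s p))) :
    S.sheaf ⟶ S.sheaf where
  val := PresheafOfModules.homMk
    { app := fun U => AddCommGrpCat.ofHom
        { toFun := fun s : S.sections U.unop =>
            (⟨fun p => φ p.1 (s.1 p), hφ s.2⟩ : S.sections U.unop)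
          map_zero' := Subtype.ext (funext fun p => map_zero (φ p.1))
          map_add' := fun s t => Subtype.ext (funext fun p => map_add (φ p.1) (s.1 p) (t.1 p)) }
      naturality := fun _ _ _ => rfl }
    (fun _ f s => Subtype.ext (funext fun p => map_smul (φ p.1) (f.1 p) (s.1 p)))

/-- The `SO(2, ℂ)`-equivariant sheaf of modules given by linear actions of `SO(2, ℂ)` on the vector
spaces `T p` preserving `S` (the group acts trivially on `ℙ¹`). -/
def SectionClass.equivariant (ρ : ∀ p, Representation ℂ SO2 (T p))
    (hρ : ∀ (g : SO2) {U : Opens P1} {s : ∀ p : U, T p},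
      S.pred s → S.pred (fun p => ρ p.1 g (s p))) :
    Action (SheafOfModules.{0} structureSheaf) SO2 where
  V := S.sheaf
  ρ :=
    { toFun := fun g => S.endo (fun p => ρ p g) (hρ g)
      map_one' := by
        refine SheafOfModules.hom_ext (PresheafOfModules.hom_ext fun U => ?_)
        refine ModuleCat.hom_ext (LinearMap.ext fun s => Subtype.ext (funext fun p => ?_))
        exact LinearMap.congr_fun (map_one (ρ p.1)) (s.1 p)
      map_mul' := fun g h => by
        refine SheafOfModules.hom_ext (PresheafOfModules.hom_ext fun U => ?_)
        refine ModuleCat.hom_ext (LinearMap.ext fun s => Subtype.ext (funext fun p => ?_))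
        exact LinearMap.congr_fun (map_mul (ρ p.1) g h) (s.1 p) }

end Sections

/-! ## The line bundles `𝒪(d)` -/

/-- Functions that are, on all of the cone over `U`, a quotient `g / h` of homogeneous polynomials
with `deg g = deg h + d`, `h` having no zero over `U`. -/
def twistPrelocal (d : ℤ) : TopCat.PrelocalPredicate (fun p : P1 => Rep p → ℂ) where
  pred {U} s := ∃ (a b : ℕ) (g h : MvPolynomial (Fin 2) ℂ), (a : ℤ) = b + d ∧
    g.IsHomogeneous a ∧ h.IsHomogeneous b ∧
    ∀ (p : U) (v : Rep p.1), MvPolynomial.eval v.1 h ≠ 0 ∧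
      s p v = MvPolynomial.eval v.1 g / MvPolynomial.eval v.1 h
  res := by
    rintro U V i f ⟨a, b, g, h, hab, hg, hh, H⟩
    exact ⟨a, b, g, h, hab, hg, hh, fun p v => H ⟨p.1, i.le p.2⟩ v⟩

/-- The sections of `𝒪(d)` over `U`: the functions on the cone over `U` (without its vertex) which
are regular and homogeneous of degree `d`. -/
def twistSections (d : ℤ) : SectionClass (fun p : P1 => Rep p → ℂ) where
  __ := (twistPrelocal d).sheafify
  zero U := by
    intro x
    obtain ⟨j, hj⟩ := exists_mem_chart x.1
    refine ⟨U ⊓ chart j, ⟨x.2, hj⟩, homOfLE inf_le_left, d.toNat, (-d).toNat, 0,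
      MvPolynomial.X j ^ (-d).toNat, by omega, MvPolynomial.isHomogeneous_zero _ _ _, ?_, ?_⟩
    · simpa using (MvPolynomial.isHomogeneous_X ℂ j).pow (-d).toNat
    · intro p v
      have := p.2.2 v
      refine ⟨by simpa using fun h => absurd h this, by simp⟩
  add hs ht := by
    refine TopCat.PrelocalPredicate.sheafify_inductionOn₂' (twistPrelocal d) (twistPrelocal d)
      (twistPrelocal d) (fun {_} a b => a + b) ?_ hs ht
    rintro U V s t ⟨a, b, g, h, hab, hg, hh, H⟩ ⟨a', b', g', h', hab', hg', hh', H'⟩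
    refine ⟨a + b', b + b', g * h' + h * g', h * h', by push_cast; omega,
      (hg.mul hh').add ?_, hh.mul hh', fun p v => ?_⟩
    · have : a + b' = b + a' := by omega
      rw [this]
      exact hh.mul hg'
    · obtain ⟨h1, e1⟩ := H ⟨p, p.2.1⟩ v
      obtain ⟨h2, e2⟩ := H' ⟨p, p.2.2⟩ v
      refine ⟨by simpa using ⟨h1, h2⟩, ?_⟩
      simp only [Pi.add_apply, e1, e2, map_add, map_mul]
      exact div_add_div _ _ h1 h2
  smul hf hs := by
    refine TopCat.PrelocalPredicate.sheafify_inductionOn₂' ratioPrelocal (twistPrelocal d)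
      (twistPrelocal d) (fun {_} a b => a • b) ?_ hf hs
    rintro U V f s ⟨e, g, h, hg, hh, H⟩ ⟨a, b, g', h', hab', hg', hh', H'⟩
    refine ⟨e + a, e + b, g * g', h * h', by push_cast; omega, hg.mul hg', hh.mul hh',
      fun p v => ?_⟩
    obtain ⟨h1, e1⟩ := H ⟨p, p.2.1⟩ v
    obtain ⟨h2, e2⟩ := H' ⟨p, p.2.2⟩ v
    refine ⟨by simpa using ⟨h1, h2⟩, ?_⟩
    simp only [Pi.smul_apply, smul_eq_mul, e1, e2, map_mul]
    exact div_mul_div_comm _ _ _ _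

/-- The representation of `SO(2, ℂ)` on a vector space by the character of weight `w`. -/
def charRep (w : ℤ) (E : Type) [AddCommGroup E] [Module ℂ E] : Representation ℂ SO2 E where
  toFun g := SO2.char w g • LinearMap.id
  map_one' := by rw [map_one, one_smul]; rfl
  map_mul' g h := by
    rw [map_mul]
    exact LinearMap.ext fun x => mul_smul _ _ _

/-- The line bundle `𝒪(d)` on `ℙ¹`, on which `k(z)` acts as multiplication by `z ^ w`. -/
def lineBundle (d w : ℤ) : Action (SheafOfModules.{0} structureSheaf) SO2 :=
  (twistSections d).equivariant (fun p => charRep w (Rep p → ℂ))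
    (fun g U _ hs => (twistSections d).smul (isRegular_const U (SO2.char w g)) hs)

/-! ## Gluing `𝔤(m)` and `𝔤(n)` along `ℂˣ` -/

/-- The coordinate `x = z₂ / z₁` on `ℂˣ = U_1 ∩ U_2`. -/
def coord {p : Pt} (h0 : p ∈ chart 0) (h1 : p ∈ chart 1) : ℂˣ :=
  Units.mk0 (p.rep.1 1 / p.rep.1 0) (div_ne_zero (h1 p.rep) (h0 p.rep))

/-- The matrix, in the bases `H_m, X_m, Y_m` and `H_n, X_n, Y_n`, of a linear map from
`𝔤(m)|_{ℂˣ}` to `𝔤(n)|_{ℂˣ}`, evaluated at a point `x` of `ℂˣ`. -/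
def matrixAt {m n : ℕ} (ψ : Fam.Loc m →ₗ[ℂ[T;T⁻¹]] Fam.Loc n) (x : ℂˣ) : Matrix Idx Idx ℂ :=
  (LinearMap.toMatrix (Fam.locBasis m) (Fam.locBasis n) ψ).map
    (LaurentPolynomial.eval₂ (RingHom.id ℂ) x)

open scoped Matrix in
/-- The fibre at `p` of the vector bundle glued from `𝔤(m)` on `U_1` and `𝔤(n)` on `U_2` via `ψ`.
An element is given by its coordinates in the basis `H_m, X_m, Y_m` if `p ∈ U_1` and its coordinates
in the basis `H_n, X_n, Y_n` if `p ∈ U_2`; if `p` is in both, `ψ` maps the former to the latter. -/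
def gluedFiber {m n : ℕ} (ψ : Fam.Loc m →ₗ[ℂ[T;T⁻¹]] Fam.Loc n) (p : Pt) :
    Submodule ℂ ({j : Fin 2 // p ∈ chart j} → Idx → ℂ) where
  carrier := {s | ∀ (h0 : p ∈ chart 0) (h1 : p ∈ chart 1),
    s ⟨1, h1⟩ = matrixAt ψ (coord h0 h1) *ᵥ s ⟨0, h0⟩}
  zero_mem' h0 h1 := (Matrix.mulVec_zero _).symm
  add_mem' {s t} hs ht h0 h1 := by
    simp only [Pi.add_apply, hs h0 h1, ht h0 h1, Matrix.mulVec_add]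
  smul_mem' c s hs h0 h1 := by
    simp only [Pi.smul_apply, hs h0 h1, Matrix.mulVec_smul]

/-- The sections of the glued bundle over `U`: on `U ∩ U_1` a combination of `H_m, X_m, Y_m` and on
`U ∩ U_2` a combination of `H_n, X_n, Y_n`, both with regular functions as coefficients, which are
identified by `ψ` over `U ∩ ℂˣ`. -/
def gluedSections {m n : ℕ} (ψ : Fam.Loc m →ₗ[ℂ[T;T⁻¹]] Fam.Loc n) :
    SectionClass (fun p : P1 => gluedFiber ψ p) where
  pred {U} s := ∀ (j : Fin 2) (i : Idx),
    isRegular.pred (fun p : (U ⊓ chart j : Opens P1) => (s ⟨p.1, p.2.1⟩).1 ⟨j, p.2.2⟩ i)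
  res {U V} f s hs j i :=
    isRegular.res (homOfLE (inf_le_inf_right _ f.le) : U ⊓ chart j ⟶ V ⊓ chart j) _ (hs j i)
  locality {U} s hs j i := by
    refine isRegular.locality _ fun x => ?_
    obtain ⟨V, hV, f, H⟩ := hs ⟨x.1, x.2.1⟩
    exact ⟨V ⊓ chart j, ⟨hV, x.2.2⟩, homOfLE (inf_le_inf_right _ f.le), H j i⟩
  zero U j i := isRegular_const _ 0
  add hs ht j i := isRegular_add (hs j i) (ht j i)
  smul {U _ _} hf hs j i :=
    isRegular_mul (isRegular.res (homOfLE inf_le_left : U ⊓ chart j ⟶ U) _ hf) (hs j i)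

lemma locAct_repr (n : ℕ) (g : SO2) (a : Fam.Loc n) (i : Idx) :
    (Fam.locBasis n).repr (Fam.locAct n g a) i =
      LaurentPolynomial.C (SO2.char i.weight g) * (Fam.locBasis n).repr a i := by
  have ha := (Fam.locBasis n).mem_span a
  induction ha using Submodule.span_induction with
  | mem a h =>
    obtain ⟨j, rfl⟩ := h
    rw [Fam.locAct_locBasis, map_smul, Module.Basis.repr_self, Finsupp.smul_apply, smul_eq_mul,
      Finsupp.single_apply]
    split_ifs with hj
    · rw [hj]
    · simp
  | zero => simp only [map_zero, Finsupp.zero_apply, mul_zero]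
  | add x y _ _ hx hy => simp only [map_add, Finsupp.add_apply, hx, hy, mul_add]
  | smul r x _ hx =>
    simp only [map_smul, Finsupp.smul_apply, smul_eq_mul, hx]
    exact mul_left_comm _ _ _

lemma matrixAt_comm {m n : ℕ} (ψ : Fam.Loc m →ₗ[ℂ[T;T⁻¹]] Fam.Loc n)
    (hψ : ∀ g a, ψ (Fam.locAct m g a) = Fam.locAct n g (ψ a)) (x : ℂˣ) (g : SO2) (i j : Idx) :
    SO2.char i.weight g * matrixAt ψ x i j = matrixAt ψ x i j * SO2.char j.weight g := by
  have h := congrArg (fun a => (Fam.locBasis n).repr a i) (hψ g (Fam.locBasis m j))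
  simp only [locAct_repr] at h
  rw [Fam.locAct_locBasis, map_smul, map_smul, Finsupp.smul_apply, smul_eq_mul] at h
  have h2 := congrArg (LaurentPolynomial.eval₂ (RingHom.id ℂ) x) h
  rw [map_mul, map_mul, LaurentPolynomial.eval₂_C, LaurentPolynomial.eval₂_C] at h2
  simp only [RingHom.id_apply] at h2
  rw [matrixAt, Matrix.map_apply, LinearMap.toMatrix_apply, ← h2, mul_comm]

/-- The action of `SO(2, ℂ)` on a fibre of the glued bundle: `k(z)` multiplies the coordinates along
`H`, `X`, `Y` by `1`, `z²`, `z⁻²`. -/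
def gluedRep {m n : ℕ} (ψ : Fam.Loc m →ₗ[ℂ[T;T⁻¹]] Fam.Loc n)
    (hψ : ∀ g a, ψ (Fam.locAct m g a) = Fam.locAct n g (ψ a)) (p : Pt) :
    Representation ℂ SO2 (gluedFiber ψ p) where
  toFun g :=
    { toFun := fun s => ⟨fun j i => SO2.char i.weight g * s.1 j i, fun h0 h1 => by
        funext i
        change SO2.char i.weight g * s.1 ⟨1, h1⟩ i = _
        rw [s.2 h0 h1]
        simp only [Matrix.mulVec, dotProduct, Finset.mul_sum]
        refine Finset.sum_congr rfl fun j _ => ?_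
        rw [← mul_assoc, ← mul_assoc, matrixAt_comm ψ hψ]⟩
      map_add' := fun s t => Subtype.ext (funext fun j => funext fun i => mul_add _ _ _)
      map_smul' := fun c s => Subtype.ext (funext fun j => funext fun i =>
        mul_left_comm _ _ _) }
  map_one' := by
    refine LinearMap.ext fun s => Subtype.ext (funext fun j => funext fun i => ?_)
    change SO2.char i.weight 1 * s.1 j i = s.1 j i
    rw [map_one, one_mul]
  map_mul' g g' := by
    refine LinearMap.ext fun s => Subtype.ext (funext fun j => funext fun i => ?_)
    change SO2.char i.weight (g * g') * s.1 j i =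
      SO2.char i.weight g * (SO2.char i.weight g' * s.1 j i)
    rw [map_mul, mul_assoc]

/-- The `SO(2, ℂ)`-equivariant sheaf on `ℙ¹` glued from `𝔤(m)` on `U_1` and `𝔤(n)` on `U_2` via an
`SO(2, ℂ)`-equivariant linear map `ψ` over `ℂˣ`. -/
def glue {m n : ℕ} (ψ : Fam.Loc m →ₗ[ℂ[T;T⁻¹]] Fam.Loc n)
    (hψ : ∀ g a, ψ (Fam.locAct m g a) = Fam.locAct n g (ψ a)) :
    Action (SheafOfModules.{0} structureSheaf) SO2 :=
  (gluedSections ψ).equivariant (gluedRep ψ hψ)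
    (fun _ _ _ hs j i => isRegular_mul (isRegular_const _ _) (hs j i))

/-- The bundle underlying `(𝔤(m), 𝔤(n), ψ^{1,k,1})`. -/
def extensionBundle (m n : ℕ) (k : ℤ) : Action (SheafOfModules.{0} structureSheaf) SO2 :=
  glue (Fam.psi m n 1 k : Fam.Loc m →ₗ[ℂ[T;T⁻¹]] Fam.Loc n) (Fam.psi_locAct m n 1 k)

/-! ## Equivariant vector bundles and isotypic pieces -/

section Equivariant

variable (F : Action (SheafOfModules.{0} structureSheaf) SO2)

/-- The constant function `c` on `U`. -/
def constSection (U : Opens P1) (c : ℂ) : structureSheaf.obj.obj (op U) :=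
  (⟨fun _ => c, isRegular_const U c⟩ : regularSubring U)

/-- The sections over `U` of the weight `w` isotypic piece: those on which `k(z)` acts as
multiplication by `z ^ w`. -/
def isotypic (w : ℤ) (U : Opens P1) : Set (F.V.val.obj (op U)) :=
  {s | ∀ g : SO2, (F.ρ g : F.V ⟶ F.V).val.app (op U) s = constSection U (SO2.char w g) • s}

/-- The underlying sheaf of modules is locally free of rank `r`. -/
def IsLocallyFreeOfRank (r : ℕ) : Prop :=
  ∀ p : P1, ∃ (V : Opens P1) (_ : p ∈ V) (e : Fin r → F.V.val.obj (op V)),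
    ∀ (W : Opens P1) (i : W ⟶ V), Function.Bijective
      (fun f : Fin r → structureSheaf.obj.obj (op W) =>
        ∑ a, f a • (F.V.val.map i.op (e a) : F.V.val.obj (op W)))

/-- The action of `SO(2, ℂ) ≅ ℂˣ` is algebraic: every section is a finite sum of weight
sections. -/
def IsAlgebraicAction : Prop :=
  ∀ (U : Opens P1) (s : F.V.val.obj (op U)), ∃ (S : Finset ℤ) (t : ℤ → F.V.val.obj (op U)),
    (∀ w, t w ∈ isotypic F w U) ∧ s = ∑ w ∈ S, t w

end Equivariant

end HCFamily
end

noncomputable section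

namespace HCFamily

/-! ## Morphisms given by families of linear maps -/

section Hom

variable {T T' : P1 → Type} [∀ p, AddCommGroup (T p)] [∀ p, Module ℂ (T p)]
  [∀ p, AddCommGroup (T' p)] [∀ p, Module ℂ (T' p)]

/-! The gluing matrix is diagonal with monomial entries, so the bundle splits along `H`, `X`, `Y`,
and each piece is recognised by its transition function. Write the entry of index `i` as `x ^ (-d)`,
which is the definition of `gluedDegree` (`d = 0`, `-k`, `k + n - m`). Since `x = z₂ / z₁`, chart
coordinates with `a₂ = x ^ (-d) * a₁` satisfy `a₁ * z₁ ^ d = a₂ * z₂ ^ d`. This common value is a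
function on the cone, regular and homogeneous of degree `d`, that is, a section of `𝒪(d)`;
conversely `F` in `𝒪(d)` has chart coordinates `F / z_j ^ d`. `gluedFiber_mul_zpow` is the
independence of the chart, while `twistSections_div_eq` and `isRegular_twist_div` show that `F / z_j
^ d` is a well-defined regular function.

Both constructions are linear on fibres and preserve the weight, hence give equivariant inclusions
`gluedIncl` and projections `gluedProj`. The relations `gluedIncl_proj`, `gluedIncl_proj_of_ne` and
`sum_gluedProj_incl` make the glued bundle a biproduct.

The weights `0, 2, -2` are distinct and `k(2)` separates characters. An equivariant map therefore
kills a section of one weight when its target line bundle has another, and the isotypic pieces are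
exactly the images of the inclusions. Algebraicity follows by splitting a section into its three
components. Local freeness holds because the sections `H, X, Y` form a frame over each chart. -/

/-- The morphism of sheaves of modules given by linear maps `T p → T' p` that send sections in the
class `S` to sections in the class `S'`. -/
def SectionClass.hom (S : SectionClass T) (S' : SectionClass T') (φ : ∀ p, T p →ₗ[ℂ] T' p)
    (hφ : ∀ {U : Opens P1} {s : ∀ p : U, T p}, S.pred s → S'.pred (fun p => φ p.1 (s p))) :
    S.sheaf ⟶ S'.sheaf where
  val := PresheafOfModules.homMk
    { app := fun U => AddCommGrpCat.ofHom
        { toFun := fun s : S.sections U.unop =>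
            (⟨fun p => φ p.1 (s.1 p), hφ s.2⟩ : S'.sections U.unop)
          map_zero' := Subtype.ext (funext fun p => map_zero (φ p.1))
          map_add' := fun s t => Subtype.ext (funext fun p => map_add (φ p.1) (s.1 p) (t.1 p)) }
      naturality := fun _ _ _ => rfl }
    (fun _ f s => Subtype.ext (funext fun p => map_smul (φ p.1) (f.1 p) (s.1 p)))

/-- The equivariant morphism given by equivariant linear maps of the fibres. -/
def SectionClass.equivariantHom {S : SectionClass T} {S' : SectionClass T'}
    {ρ : ∀ p, Representation ℂ SO2 (T p)} {ρ' : ∀ p, Representation ℂ SO2 (T' p)}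
    (hρ : ∀ (g : SO2) {U : Opens P1} {s : ∀ p : U, T p},
      S.pred s → S.pred (fun p => ρ p.1 g (s p)))
    (hρ' : ∀ (g : SO2) {U : Opens P1} {s : ∀ p : U, T' p},
      S'.pred s → S'.pred (fun p => ρ' p.1 g (s p)))
    (φ : ∀ p, T p →ₗ[ℂ] T' p)
    (hφ : ∀ {U : Opens P1} {s : ∀ p : U, T p}, S.pred s → S'.pred (fun p => φ p.1 (s p)))
    (hφρ : ∀ p g x, φ p (ρ p g x) = ρ' p g (φ p x)) :
    S.equivariant ρ hρ ⟶ S'.equivariant ρ' hρ' where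
  hom := S.hom S' φ hφ
  comm g := by
    refine SheafOfModules.hom_ext (PresheafOfModules.hom_ext fun U => ?_)
    refine ModuleCat.hom_ext (LinearMap.ext fun s => Subtype.ext (funext fun p => ?_))
    exact hφρ p.1 g (s.1 p)

/-- Two equivariant morphisms agree if they agree on all sections. -/
lemma equivariant_hom_ext {F G : Action (SheafOfModules.{0} structureSheaf) SO2} {f g : F ⟶ G}
    (h : ∀ (U : Opens P1) (s : F.V.val.obj (op U)),
      f.hom.val.app (op U) s = g.hom.val.app (op U) s) : f = g := by
  refine Action.Hom.ext (SheafOfModules.hom_ext (PresheafOfModules.hom_ext fun U => ?_))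
  exact ModuleCat.hom_ext (LinearMap.ext fun s => h U.unop s)

end Hom

/-! ## Regular functions and sections of `𝒪(d)` on the standard open sets -/

/-- Every monomial in the support has total degree `d`, so each term picks up the same factor `c ^
d`. -/
lemma _root_.MvPolynomial.IsHomogeneous.eval_smul {σ R : Type*} [CommSemiring R] {d : ℕ}
    {f : MvPolynomial σ R} (hf : f.IsHomogeneous d) (c : R) (v : σ → R) :
    MvPolynomial.eval (c • v) f = c ^ d * MvPolynomial.eval v f := by
  rw [MvPolynomial.eval_eq, MvPolynomial.eval_eq, Finset.mul_sum]
  refine Finset.sum_congr rfl fun e he => ?_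
  have hd : ∑ i ∈ e.support, e i = d := by
    rw [← hf (MvPolynomial.mem_support_iff.1 he), Finsupp.weight_apply, Finsupp.sum]
    simp
  simp only [Pi.smul_apply, smul_eq_mul, mul_pow, Finset.prod_mul_distrib,
    Finset.prod_pow_eq_pow_sum, hd]
  ring

/-- Polynomials have only natural exponents, so `d` is split as `d.toNat - (-d).toNat`; this treats
both signs of `d` at once. -/
lemma zpow_eq_div_toNat {a : ℂ} (ha : a ≠ 0) (d : ℤ) :
    a ^ d = a ^ d.toNat / a ^ (-d).toNat := by
  rw [← zpow_natCast, ← zpow_natCast, ← zpow_sub₀ ha]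
  congr 1
  omega

/-- `z_j ^ d` is a section of `𝒪(d)` over any open subset of `{z_j ≠ 0}`. -/
lemma twistSections_pow (d : ℤ) (j : Fin 2) {U : Opens P1} (hU : U ≤ chart j) :
    (twistSections d).pred (fun (p : U) (v : Rep p.1) => v.1 j ^ d) := by
  refine TopCat.PrelocalPredicate.sheafifyOf ?_
  refine ⟨d.toNat, (-d).toNat, MvPolynomial.X j ^ d.toNat, MvPolynomial.X j ^ (-d).toNat,
    by omega, ?_, ?_, fun p v => ?_⟩
  · simpa using (MvPolynomial.isHomogeneous_X ℂ j).pow d.toNat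
  · simpa using (MvPolynomial.isHomogeneous_X ℂ j).pow (-d).toNat
  · have hv : v.1 j ≠ 0 := hU p.2 v
    simp only [map_pow, MvPolynomial.eval_X]
    exact ⟨pow_ne_zero _ hv, zpow_eq_div_toNat hv d⟩

/-- Sections of `𝒪(d)` are homogeneous of degree `d`: dividing by `z_j ^ d` gives a function on `ℙ¹`. -/
lemma twistSections_div_eq {d : ℤ} {U : Opens P1} {F : ∀ p : U, Rep p.1 → ℂ}
    (hF : (twistSections d).pred F) (p : U) (v w : Rep p.1) (j : Fin 2) (hj : p.1 ∈ chart j) :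
    F p v / v.1 j ^ d = F p w / w.1 j ^ d := by
  -- A single presentation `g / h` is valid on the whole cone over a neighbourhood of `p`, hence at
  -- both `v` and `w`.
  obtain ⟨V, hV, i, a, b, g, h, hab, hg, hh, H⟩ := hF p
  obtain ⟨c, hc⟩ := Rep.eq_smul v w
  have hF' : ∀ u : Rep p.1, MvPolynomial.eval u.1 h ≠ 0 ∧
      F p u = MvPolynomial.eval u.1 g / MvPolynomial.eval u.1 h := H ⟨p.1, hV⟩
  have hw : w.1 j ≠ 0 := hj w
  have hc0 : (c : ℂ) ≠ 0 := c.ne_zero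
  have hv : v.1 = (c : ℂ) • w.1 := hc.symm
  -- Passing from `w` to `v = c • w` multiplies `g`, `h` and `z_j ^ d` by `c ^ a`, `c ^ b` and `c ^
  -- d`; these factors cancel because `a = b + d`.
  have ha : (c : ℂ) ^ a = (c : ℂ) ^ b * (c : ℂ) ^ d := by
    rw [← zpow_natCast, ← zpow_natCast, hab, zpow_add₀ hc0]
  have hh0 := (hF' w).1
  rw [(hF' v).2, (hF' w).2, hv, hg.eval_smul, hh.eval_smul, Pi.smul_apply, smul_eq_mul, mul_zpow,
    ha]
  field_simp

/-- A section of `𝒪(d)` divided by `z_j ^ d` is a regular function on `{z_j ≠ 0}`. -/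
lemma isRegular_twist_div (d : ℤ) (j : Fin 2) {U : Opens P1} (hU : U ≤ chart j)
    {F : ∀ p : U, Rep p.1 → ℂ} (hF : (twistSections d).pred F) :
    isRegular.pred (fun p : U => F p p.1.rep / p.1.rep.1 j ^ d) := by
  intro x
  obtain ⟨V, hV, i, a, b, g, h, hab, hg, hh, H⟩ := hF x
  -- Dividing `g / h` by `z_j ^ d` puts the negative part of `d` in the numerator and the positive
  -- part in the denominator; the degrees agree since `a = b + d`.
  refine ⟨V, hV, i, a + (-d).toNat, g * MvPolynomial.X j ^ (-d).toNat,
    h * MvPolynomial.X j ^ d.toNat, ?_, ?_, fun p v => ?_⟩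
  · simpa using hg.mul ((MvPolynomial.isHomogeneous_X ℂ j).pow (-d).toNat)
  · have : a + (-d).toNat = b + d.toNat := by omega
    rw [this]
    simpa using hh.mul ((MvPolynomial.isHomogeneous_X ℂ j).pow d.toNat)
  · have hv : v.1 j ≠ 0 := hU (i.le p.2) v
    obtain ⟨hv', -⟩ := H p v
    refine ⟨by simpa using ⟨hv', fun h => absurd h hv⟩, ?_⟩
    have e : F ⟨p.1, i.le p.2⟩ v = _ := (H p v).2
    change F ⟨p.1, i.le p.2⟩ p.1.rep / p.1.rep.1 j ^ d = _
    rw [twistSections_div_eq hF ⟨p.1, i.le p.2⟩ p.1.rep v j (hU (i.le p.2)), e, zpow_eq_div_toNat hv,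
      div_div_div_eq, map_mul, map_mul, map_pow, map_pow, MvPolynomial.eval_X]


/-! ## Isotypic pieces -/

/-- The element `k(2)` separates the characters of `SO(2, ℂ)`. -/
lemma SO2.exists_char_ne {w w' : ℤ} (h : w ≠ w') : ∃ g : SO2, SO2.char w g ≠ SO2.char w' g := by
  refine ⟨⟨⟨!![2, 0; 0, 2⁻¹], by simp [Matrix.det_fin_two]⟩, by simp, by simp⟩, fun hg => h ?_⟩
  change ((_ ^ w : ℂˣ) : ℂ) = ((_ ^ w' : ℂˣ) : ℂ) at hg
  rw [Units.val_zpow_eq_zpow_val, Units.val_zpow_eq_zpow_val] at hg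
  change (2 : ℂ) ^ w = (2 : ℂ) ^ w' at hg
  -- Taking norms moves the equality to `ℝ`, where integer powers of `2` are injective by
  -- monotonicity.
  have h2 : (2 : ℝ) ^ w = (2 : ℝ) ^ w' := by simpa using congrArg norm hg
  exact zpow_right_injective₀ (by norm_num) (by norm_num) h2

/-- Equivariant morphisms preserve isotypic pieces. -/
lemma map_mem_isotypic {F G : Action (SheafOfModules.{0} structureSheaf) SO2} (f : F ⟶ G) {w : ℤ}
    {U : Opens P1} {s : F.V.val.obj (op U)} (hs : s ∈ isotypic F w U) :
    (f.hom.val.app (op U) s : G.V.val.obj (op U)) ∈ isotypic G w U := fun g => by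
  have h : (G.ρ g : G.V ⟶ G.V).val.app (op U) (f.hom.val.app (op U) s) =
      f.hom.val.app (op U) ((F.ρ g : F.V ⟶ F.V).val.app (op U) s) :=
    congrArg (fun φ : F.V ⟶ G.V => φ.val.app (op U) s) (f.comm g).symm
  rw [h, hs g]
  exact map_smul (f.hom.val.app (op U)).hom _ _

lemma mem_isotypic_lineBundle (d w : ℤ) (U : Opens P1) (s : (lineBundle d w).V.val.obj (op U)) :
    s ∈ isotypic (lineBundle d w) w U := fun _ => rfl

/-- Some group element separates the two characters, and it would multiply each value of `s` by two
different scalars. -/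
lemma eq_zero_of_mem_isotypic_lineBundle {d w w' : ℤ} (h : w ≠ w') {U : Opens P1}
    {s : (lineBundle d w).V.val.obj (op U)} (hs : s ∈ isotypic (lineBundle d w) w' U) : s = 0 := by
  obtain ⟨g, hg⟩ := SO2.exists_char_ne h
  refine Subtype.ext (funext fun p => funext fun v => ?_)
  have h1 : SO2.char w g * s.1 p v = SO2.char w' g * s.1 p v :=
    congrArg (fun t : (twistSections d).sections U => t.1 p v) (hs g)
  exact (mul_eq_mul_right_iff.1 h1).resolve_left hg

lemma zero_mem_isotypic (F : Action (SheafOfModules.{0} structureSheaf) SO2) (w : ℤ)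
    (U : Opens P1) : (0 : F.V.val.obj (op U)) ∈ isotypic F w U := fun g =>
  (map_zero ((F.ρ g : F.V ⟶ F.V).val.app (op U)).hom).trans (smul_zero _).symm

/-! ## The weight decomposition of the glued bundle -/

/-- The degrees of the line bundles spanned by `H`, `X` and `Y`. -/
def gluedDegree (m n : ℕ) (k : ℤ) : Idx → ℤ
  | .H => 0
  | .X => -k
  | .Y => k + n - m

/-- An object with inclusions and projections for three summands is their biproduct. -/
def isoBiprodBiprod {C : Type*} [Category* C] [Preadditive C] [HasBinaryBiproducts C] {E : C}
    (B : Idx → C) (ι : ∀ i, B i ⟶ E) (π : ∀ i, E ⟶ B i) (h : ∀ i, ι i ≫ π i = 𝟙 _)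
    (h' : ∀ i j, i ≠ j → ι i ≫ π j = 0) (hs : π .H ≫ ι .H + (π .X ≫ ι .X + π .Y ≫ ι .Y) = 𝟙 E) :
    E ≅ B .H ⊞ (B .X ⊞ B .Y) where
  hom := biprod.lift (π .H) (biprod.lift (π .X) (π .Y))
  inv := biprod.desc (ι .H) (biprod.desc (ι .X) (ι .Y))
  hom_inv_id := by rw [biprod.lift_desc, biprod.lift_desc, hs]
  inv_hom_id := by
    -- The nine entries of a `3 × 3` matrix of morphisms: identities on the diagonal by `h`, zeros
    -- elsewhere by `h'`.
    refine biprod.hom_ext' _ _ ?_ (biprod.hom_ext' _ _ ?_ ?_) <;>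
    refine biprod.hom_ext _ _ ?_ (biprod.hom_ext _ _ ?_ ?_) <;>
    simp [h, h']

lemma Idx.weight_injective : Function.Injective Idx.weight := by
  intro i j h
  cases i <;> cases j <;> simp_all [Idx.weight]

/-! ### The diagonal transition matrix and the splitting on fibres -/

section Glued

variable (m n : ℕ) (k : ℤ)

/-- The linear map underlying `ψ^{1,k,1}`. -/
abbrev psiMap : Fam.Loc m →ₗ[ℂ[T;T⁻¹]] Fam.Loc n :=
  (Fam.psi m n 1 k : Fam.Loc m →ₗ[ℂ[T;T⁻¹]] Fam.Loc n)

/-- Each basis vector is sent to a power of `x` times its counterpart, so the matrix is diagonal;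
the sign in `gluedDegree` makes every exponent `-d`. -/
lemma matrixAt_psi_mulVec (x : ℂˣ) (a : Idx → ℂ) (i : Idx) :
    (matrixAt (psiMap m n k) x).mulVec a i = (x : ℂ) ^ (-gluedDegree m n k i) * a i := by
  have hentry : ∀ i j, matrixAt (psiMap m n k) x i j =
      if i = j then (x : ℂ) ^ (-gluedDegree m n k j) else 0 := by
    intro i j
    have h : psiMap m n k (Fam.locBasis m j) = Fam.psiCoeff m n 1 k j • Fam.locBasis n j :=
      Fam.psi_locBasis m n 1 k j
    rw [matrixAt, Matrix.map_apply, LinearMap.toMatrix_apply, h, map_smul, Module.Basis.repr_self,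
      Finsupp.smul_apply, smul_eq_mul, Finsupp.single_apply]
    by_cases hij : i = j
    · subst hij
      simp only [if_true, mul_one]
      cases i
      · simp [Fam.psiCoeff, gluedDegree]
      · simp [Fam.psiCoeff, gluedDegree]
      · simp only [Fam.psiCoeff, gluedDegree, inv_one, Units.val_one, map_one, one_mul,
          LaurentPolynomial.eval₂_T]
        rw [← Units.val_zpow_eq_zpow_val]
        congr 2
        ring
    · rw [if_neg (Ne.symm hij), if_neg hij, mul_zero, map_zero]
  simp only [Matrix.mulVec, dotProduct, hentry, ite_mul, zero_mul, Finset.sum_ite_eq,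
    Finset.mem_univ, if_true]

variable {m n k} in
/-- In the fibre of the glued bundle over `p`, the `i`-th coordinate times `z_j ^ d`, `d` being the
degree of the `i`-th summand, is independent of the chart `j`. -/
lemma gluedFiber_mul_zpow {p : Pt} (s : gluedFiber (psiMap m n k) p) (i : Idx) (v : Rep p)
    (j j' : Fin 2) (hj : p ∈ chart j) (hj' : p ∈ chart j') :
    s.1 ⟨j, hj⟩ i * v.1 j ^ gluedDegree m n k i =
      s.1 ⟨j', hj'⟩ i * v.1 j' ^ gluedDegree m n k i := by
  have key : ∀ (h0 : p ∈ chart 0) (h1 : p ∈ chart 1),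
      s.1 ⟨0, h0⟩ i * v.1 0 ^ gluedDegree m n k i =
        s.1 ⟨1, h1⟩ i * v.1 1 ^ gluedDegree m n k i := by
    intro h0 h1
    obtain ⟨c, hc⟩ := Rep.eq_smul p.rep v
    have hr : ∀ j, p.rep.1 j = c * v.1 j := fun j => (congrFun hc j).symm
    have hv0 : v.1 0 ≠ 0 := h0 v
    have hv1 : v.1 1 ≠ 0 := h1 v
    -- `coord` is computed from the chosen representative, but the scalar relating it to `v` cancels
    -- in the quotient.
    have hx : (coord h0 h1 : ℂ) = v.1 1 / v.1 0 := by
      change p.rep.1 1 / p.rep.1 0 = _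
      rw [hr, hr, mul_div_mul_left _ _ c.ne_zero]
    rw [s.2 h0 h1, matrixAt_psi_mulVec, hx, zpow_neg, div_zpow]
    field_simp
  have h01 : ∀ j : Fin 2, j = 0 ∨ j = 1 := by decide
  rcases h01 j with rfl | rfl <;> rcases h01 j' with rfl | rfl
  · rfl
  · exact key _ _
  · exact (key _ _).symm
  · rfl

/-- The inclusion of the `i`-th summand, on fibres. -/
def fiberIncl (i : Idx) (p : Pt) : (Rep p → ℂ) →ₗ[ℂ] gluedFiber (psiMap m n k) p where
  -- Both chart coordinates use the same value `F p.rep`, so they are compatible with the gluing for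
  -- every `F`, homogeneous or not.
  toFun F := ⟨fun j => Pi.single i (F p.rep / p.rep.1 j.1 ^ gluedDegree m n k i), fun h0 h1 => by
    funext i'
    rw [matrixAt_psi_mulVec]
    beta_reduce
    by_cases hi : i' = i
    · subst hi
      have h0' : p.rep.1 0 ≠ 0 := h0 _
      have h1' : p.rep.1 1 ≠ 0 := h1 _
      have hx : (coord h0 h1 : ℂ) = p.rep.1 1 / p.rep.1 0 := rfl
      rw [Pi.single_eq_same, Pi.single_eq_same, hx, zpow_neg, div_zpow]
      field_simp
    · rw [Pi.single_eq_of_ne hi, Pi.single_eq_of_ne hi, mul_zero]⟩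
  map_add' F G := Subtype.ext (funext fun j => by
    simp only [Pi.add_apply, add_div, Pi.single_add, Submodule.coe_add])
  map_smul' c F := Subtype.ext (funext fun j => by
    simp only [Pi.smul_apply, smul_eq_mul, mul_div_assoc, RingHom.id_apply, Submodule.coe_smul]
    rw [← smul_eq_mul, Pi.single_smul])

/-- The projection to the `i`-th summand, on fibres. -/
def fiberProj (i : Idx) (p : Pt) : gluedFiber (psiMap m n k) p →ₗ[ℂ] (Rep p → ℂ) where
  toFun s v := s.1 ⟨_, (exists_mem_chart p).choose_spec⟩ i *
    v.1 (exists_mem_chart p).choose ^ gluedDegree m n k i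
  map_add' _ _ := funext fun _ => add_mul _ _ _
  map_smul' _ _ := funext fun _ => mul_assoc _ _ _

-- The arbitrary choice of chart in `fiberProj` is harmless: any chart through `p` computes the same
-- function.
variable {m n k} in
lemma fiberProj_apply {i : Idx} {p : Pt} (s : gluedFiber (psiMap m n k) p) (v : Rep p) (j : Fin 2)
    (hj : p ∈ chart j) :
    fiberProj m n k i p s v = s.1 ⟨j, hj⟩ i * v.1 j ^ gluedDegree m n k i :=
  gluedFiber_mul_zpow s i v _ _ _ _

variable {m n k} in
lemma fiberIncl_apply {i : Idx} {p : Pt} (F : Rep p → ℂ) (j : {j : Fin 2 // p ∈ chart j}) :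
    (fiberIncl m n k i p F).1 j = Pi.single i (F p.rep / p.rep.1 j.1 ^ gluedDegree m n k i) := rfl

lemma gluedSections_fiberIncl (i : Idx) {U : Opens P1} {F : ∀ p : U, Rep p.1 → ℂ}
    (hF : (twistSections (gluedDegree m n k i)).pred F) :
    (gluedSections (psiMap m n k)).pred (fun p => fiberIncl m n k i p.1 (F p)) := by
  intro j i'
  by_cases hi : i' = i
  · subst hi
    simp only [fiberIncl_apply, Pi.single_eq_same]
    exact isRegular_twist_div _ j inf_le_right
      ((twistSections _).res (homOfLE inf_le_left : U ⊓ chart j ⟶ U) F hF)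
  · simp only [fiberIncl_apply, Pi.single_eq_of_ne hi]
    exact isRegular_const _ 0

lemma twistSections_fiberProj (i : Idx) {U : Opens P1}
    {s : ∀ p : U, gluedFiber (psiMap m n k) p.1} (hs : (gluedSections (psiMap m n k)).pred s) :
    (twistSections (gluedDegree m n k i)).pred (fun p => fiberProj m n k i p.1 (s p)) := by
  -- The chart chosen by `fiberProj` may vary with the point. Locally one fixed chart can be used,
  -- and there the projection is a regular coordinate times the section `z_j ^ d`.
  refine (twistSections (gluedDegree m n k i)).locality _ fun x => ?_
  obtain ⟨j, hj⟩ := exists_mem_chart x.1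
  refine ⟨U ⊓ chart j, ⟨x.2, hj⟩, homOfLE inf_le_left, ?_⟩
  convert (twistSections (gluedDegree m n k i)).smul (hs j i)
    (twistSections_pow (gluedDegree m n k i) j (inf_le_right : U ⊓ chart j ≤ chart j)) using 1
  funext p v
  exact fiberProj_apply _ v j p.2.2

/-! ### Equivariant inclusions and projections -/

/-- The inclusion of `𝒪(d_i)` into the glued bundle. -/
def gluedIncl (i : Idx) : lineBundle (gluedDegree m n k i) i.weight ⟶ extensionBundle m n k :=
  SectionClass.equivariantHom _ _ (fiberIncl m n k i) (gluedSections_fiberIncl m n k i)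
    fun p g F => by
      refine Subtype.ext (funext fun j => funext fun i' => ?_)
      change (fiberIncl m n k i p (SO2.char i.weight g • F)).1 j i' =
        SO2.char i'.weight g * (fiberIncl m n k i p F).1 j i'
      rw [map_smul]
      change SO2.char i.weight g * (fiberIncl m n k i p F).1 j i' = _
      rw [fiberIncl_apply]
      by_cases hi : i' = i
      · rw [hi]
      · rw [Pi.single_eq_of_ne hi, mul_zero, mul_zero]

/-- The projection from the glued bundle to `𝒪(d_i)`. -/
def gluedProj (i : Idx) : extensionBundle m n k ⟶ lineBundle (gluedDegree m n k i) i.weight :=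
  SectionClass.equivariantHom _ _ (fiberProj m n k i) (twistSections_fiberProj m n k i)
    fun p g s => by
      funext v
      exact mul_assoc _ _ _

/-- This fails for arbitrary functions on `Rep p`, since `fiberIncl` only sees the value at the
chosen representative. Homogeneity of sections of `𝒪(d)` recovers the value at every `v`. -/
lemma gluedIncl_proj (i : Idx) : gluedIncl m n k i ≫ gluedProj m n k i = 𝟙 _ := by
  refine equivariant_hom_ext fun U F => Subtype.ext (funext fun p => funext fun v => ?_)
  obtain ⟨j, hj⟩ := exists_mem_chart p.1
  change fiberProj m n k i p.1 (fiberIncl m n k i p.1 (F.1 p)) v = F.1 p v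
  have hv : v.1 j ≠ 0 := hj v
  rw [fiberProj_apply _ v j hj, fiberIncl_apply, Pi.single_eq_same,
    twistSections_div_eq F.2 p p.1.rep v j hj, div_mul_cancel₀ _ (zpow_ne_zero _ hv)]

lemma gluedIncl_proj_of_ne {i i' : Idx} (h : i ≠ i') :
    gluedIncl m n k i ≫ gluedProj m n k i' = 0 := by
  refine equivariant_hom_ext fun U F => Subtype.ext (funext fun p => funext fun v => ?_)
  obtain ⟨j, hj⟩ := exists_mem_chart p.1
  change fiberProj m n k i' p.1 (fiberIncl m n k i p.1 (F.1 p)) v = 0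
  rw [fiberProj_apply _ v j hj, fiberIncl_apply, Pi.single_eq_of_ne h.symm, zero_mul]

/-- Unlike the opposite composite, this one needs no homogeneity: multiplying and dividing by `z_j ^
d` cancels on each fibre. -/
lemma fiberIncl_fiberProj (i : Idx) (p : Pt) (s : gluedFiber (psiMap m n k) p)
    (j : {j : Fin 2 // p ∈ chart j}) :
    (fiberIncl m n k i p (fiberProj m n k i p s)).1 j = Pi.single i (s.1 j i) := by
  have hv : p.rep.1 j.1 ≠ 0 := j.2 p.rep
  rw [fiberIncl_apply, fiberProj_apply s p.rep j.1 j.2, mul_div_cancel_right₀ _ (zpow_ne_zero _ hv)]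

lemma sum_gluedProj_incl :
    gluedProj m n k .H ≫ gluedIncl m n k .H + (gluedProj m n k .X ≫ gluedIncl m n k .X +
      gluedProj m n k .Y ≫ gluedIncl m n k .Y) = 𝟙 _ := by
  refine equivariant_hom_ext fun U s => Subtype.ext (funext fun p => Subtype.ext
    (funext fun j => ?_))
  have h := fun i => fiberIncl_fiberProj m n k i p.1 (s.1 p) j
  change (fiberIncl m n k .H p.1 (fiberProj m n k .H p.1 (s.1 p))).1 j +
    ((fiberIncl m n k .X p.1 (fiberProj m n k .X p.1 (s.1 p))).1 j +
    (fiberIncl m n k .Y p.1 (fiberProj m n k .Y p.1 (s.1 p))).1 j) = (s.1 p).1 j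
  rw [h, h, h]
  funext i
  cases i <;> simp

/-- The decomposition of the glued bundle as a sum of equivariant line bundles. -/
def gluedIso : extensionBundle m n k ≅
    lineBundle 0 0 ⊞ (lineBundle (-k) 2 ⊞ lineBundle (k + n - m) (-2)) :=
  isoBiprodBiprod (fun i => lineBundle (gluedDegree m n k i) i.weight) (gluedIncl m n k)
    (gluedProj m n k) (gluedIncl_proj m n k) (fun _ _ => gluedIncl_proj_of_ne m n k)
    (sum_gluedProj_incl m n k)

/-- This and the next two lemmas translate the biproduct inclusions into `gluedIncl`, for which the
isotypic pieces are computed. -/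
lemma inl_gluedIso_inv : biprod.inl ≫ (gluedIso m n k).inv = gluedIncl m n k .H :=
  biprod.inl_desc _ _

lemma inl_inr_gluedIso_inv :
    (biprod.inl ≫ biprod.inr) ≫ (gluedIso m n k).inv = gluedIncl m n k .X :=
  (Category.assoc _ _ _).trans
    ((congrArg (biprod.inl ≫ ·) (biprod.inr_desc _ _)).trans (biprod.inl_desc _ _))

lemma inr_inr_gluedIso_inv :
    (biprod.inr ≫ biprod.inr) ≫ (gluedIso m n k).inv = gluedIncl m n k .Y :=
  (Category.assoc _ _ _).trans
    ((congrArg (biprod.inr ≫ ·) (biprod.inr_desc _ _)).trans (biprod.inr_desc _ _))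

/-! ### Isotypic pieces and algebraicity of the glued bundle -/

/-- The component of a section of the glued bundle in the `i`-th summand. -/
def gluedComponent (i : Idx) {U : Opens P1} (s : (extensionBundle m n k).V.val.obj (op U)) :
    (extensionBundle m n k).V.val.obj (op U) :=
  (gluedIncl m n k i).hom.val.app (op U) ((gluedProj m n k i).hom.val.app (op U) s)

lemma sum_gluedComponent {U : Opens P1} (s : (extensionBundle m n k).V.val.obj (op U)) :
    gluedComponent m n k .H s + (gluedComponent m n k .X s + gluedComponent m n k .Y s) = s :=
  congrArg (fun f : extensionBundle m n k ⟶ extensionBundle m n k => f.hom.val.app (op U) s)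
    (sum_gluedProj_incl m n k)

lemma gluedComponent_mem_isotypic (i : Idx) {U : Opens P1}
    (s : (extensionBundle m n k).V.val.obj (op U)) :
    gluedComponent m n k i s ∈ isotypic (extensionBundle m n k) i.weight U :=
  map_mem_isotypic _ (mem_isotypic_lineBundle _ _ U _)

-- The projection is equivariant, so it carries `s` to a section of weight `i.weight` in a line
-- bundle of the different weight `j.weight`; such a section is zero.
variable {m n k} in
lemma gluedComponent_eq_zero {i j : Idx} (hij : j ≠ i) {U : Opens P1}
    {s : (extensionBundle m n k).V.val.obj (op U)}
    (hs : s ∈ isotypic (extensionBundle m n k) i.weight U) : gluedComponent m n k j s = 0 := by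
  have h := eq_zero_of_mem_isotypic_lineBundle (Idx.weight_injective.ne hij)
    (map_mem_isotypic (gluedProj m n k j) hs)
  rw [gluedComponent, h]
  exact map_zero ((gluedIncl m n k j).hom.val.app (op U)).hom

lemma isotypic_extensionBundle (i : Idx) (U : Opens P1) :
    isotypic (extensionBundle m n k) i.weight U =
      Set.range ((gluedIncl m n k i).hom.val.app (op U)) := by
  refine Set.Subset.antisymm (fun s hs => ⟨(gluedProj m n k i).hom.val.app (op U) s, ?_⟩) ?_
  · change gluedComponent m n k i s = s
    -- The components with the other two weights vanish, so the decomposition of `s` reduces to its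
    -- `i`-th component.
    have h := sum_gluedComponent m n k s
    have h0 := fun j (hj : j ≠ i) => gluedComponent_eq_zero hj hs
    cases i
    · rwa [h0 .X (by decide), h0 .Y (by decide), add_zero, add_zero] at h
    · rwa [h0 .H (by decide), h0 .Y (by decide), add_zero, zero_add] at h
    · rwa [h0 .H (by decide), h0 .X (by decide), zero_add, zero_add] at h
  · rintro _ ⟨t, rfl⟩
    exact map_mem_isotypic _ (mem_isotypic_lineBundle _ _ U t)

lemma isAlgebraicAction_extensionBundle : IsAlgebraicAction (extensionBundle m n k) := by
  intro U s
  -- The family is indexed by all integers, hence the value `0` away from the three weights.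
  refine ⟨{0, 2, -2}, fun w => if w = 0 then gluedComponent m n k .H s else
    if w = 2 then gluedComponent m n k .X s else
    if w = -2 then gluedComponent m n k .Y s else 0, fun w => ?_, ?_⟩
  · beta_reduce
    split_ifs with h h h
    · exact h ▸ gluedComponent_mem_isotypic m n k .H s
    · exact h ▸ gluedComponent_mem_isotypic m n k .X s
    · exact h ▸ gluedComponent_mem_isotypic m n k .Y s
    · exact zero_mem_isotypic _ _ _
  · rw [Finset.sum_insert (by decide), Finset.sum_insert (by decide), Finset.sum_singleton]
    exact (sum_gluedComponent m n k s).symm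

/-! ## Local freeness -/

variable {m n k} in
/-- An element of a fibre of the glued bundle is determined by its coordinates in one chart. -/
lemma gluedFiber_ext {p : Pt} {s t : gluedFiber (psiMap m n k) p} (j : Fin 2) (hj : p ∈ chart j)
    (h : ∀ i, s.1 ⟨j, hj⟩ i = t.1 ⟨j, hj⟩ i) : s = t := by
  refine Subtype.ext (funext fun j' => funext fun i => ?_)
  have hv : p.rep.1 j'.1 ≠ 0 := j'.2 p.rep
  refine mul_right_cancel₀ (zpow_ne_zero (gluedDegree m n k i) hv) ?_
  rw [gluedFiber_mul_zpow s i p.rep j'.1 j j'.2 hj, gluedFiber_mul_zpow t i p.rep j'.1 j j'.2 hj, h]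

/-- The sections `H`, `X`, `Y` of the glued bundle over one of the two charts. -/
def gluedFrame (j : Fin 2) (i : Idx) : (extensionBundle m n k).V.val.obj (op (chart j)) :=
  (⟨fun p => fiberIncl m n k i p.1 (fun v => v.1 j ^ gluedDegree m n k i),
    gluedSections_fiberIncl m n k i (twistSections_pow (gluedDegree m n k i) j le_rfl)⟩ :
    (gluedSections (psiMap m n k)).sections (chart j))

/-- The basis sections, indexed by `Fin 3`. -/
def idxFin : Fin 3 → Idx := ![.H, .X, .Y]

lemma isLocallyFreeOfRank_extensionBundle : IsLocallyFreeOfRank (extensionBundle m n k) 3 := by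
  intro p
  obtain ⟨j, hj⟩ := exists_mem_chart p
  refine ⟨chart j, hj, fun a => gluedFrame m n k j (idxFin a), fun W i => ?_⟩
  let Φ : (Fin 3 → structureSheaf.obj.obj (op W)) →
      (gluedSections (psiMap m n k)).sections W := fun f =>
    ∑ a, f a •
      ((extensionBundle m n k).V.val.map i.op (gluedFrame m n k j (idxFin a)) :
        (extensionBundle m n k).V.val.obj (op W))
  -- In chart `j` the frame has the standard basis vectors as coordinates, so the coefficients of a
  -- combination are its coordinates there. Injectivity and surjectivity both follow from this.
  have hΦ : ∀ (f : Fin 3 → structureSheaf.obj.obj (op W)) (q : W) (b : Fin 3),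
      ((Φ f).1 q).1 ⟨j, i.le q.2⟩ (idxFin b) = (show regularSubring W from f b).1 q := by
    intro f q b
    have hv : q.1.rep.1 j ≠ 0 := i.le q.2 _
    have h1 : ∀ c, (fiberIncl m n k c q.1 (fun v => v.1 j ^ gluedDegree m n k c)).1 ⟨j, i.le q.2⟩ =
        Pi.single c 1 := fun c => by
      rw [fiberIncl_apply, div_self (zpow_ne_zero _ hv)]
    have h2 : Φ f = _ := Fin.sum_univ_three _
    rw [h2]
    let φ : Idx → Idx → ℂ := fun c =>
      (fiberIncl m n k c q.1 (fun v => v.1 j ^ gluedDegree m n k c)).1 ⟨j, i.le q.2⟩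
    let f' : Fin 3 → regularSubring W := f
    change (f' 0).1 q * φ .H (idxFin b) + (f' 1).1 q * φ .X (idxFin b) +
      (f' 2).1 q * φ .Y (idxFin b) = (f' b).1 q
    simp only [φ, h1]
    fin_cases b <;> simp [idxFin]
  change Function.Bijective Φ
  refine ⟨fun f f' hf => funext fun b => Subtype.ext (funext fun q => ?_), fun s => ?_⟩
  · rw [← hΦ f, ← hΦ f', hf]
  · refine ⟨fun b => ⟨fun q => (s.1 q).1 ⟨j, i.le q.2⟩ (idxFin b), ?_⟩, ?_⟩
    · exact isRegular.res (homOfLE (le_inf le_rfl i.le) : W ⟶ W ⊓ chart j) _ (s.2 j (idxFin b))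
    · refine Subtype.ext (funext fun q => gluedFiber_ext j (i.le q.2) fun c => ?_)
      obtain ⟨b, rfl⟩ : ∃ b, idxFin b = c := by
        cases c
        exacts [⟨0, rfl⟩, ⟨1, rfl⟩, ⟨2, rfl⟩]
      exact hΦ _ q b

end Glued

end HCFamily
end

open HCFamily in
theorem mainTheorem10 (m n : ℕ) (k : ℤ) :
    IsLocallyFreeOfRank (extensionBundle m n k) 3 ∧ IsAlgebraicAction (extensionBundle m n k) ∧
    ∃ e : extensionBundle m n k ≅
        lineBundle 0 0 ⊞ (lineBundle (-k) 2 ⊞ lineBundle (k + n - m) (-2)),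
      ∀ U : Opens P1,
        isotypic (extensionBundle m n k) 0 U =
          Set.range ((biprod.inl ≫ e.inv).hom.val.app (op U)) ∧
        isotypic (extensionBundle m n k) 2 U =
          Set.range (((biprod.inl ≫ biprod.inr) ≫ e.inv).hom.val.app (op U)) ∧
        isotypic (extensionBundle m n k) (-2) U =
          Set.range (((biprod.inr ≫ biprod.inr) ≫ e.inv).hom.val.app (op U)) := by
  refine ⟨isLocallyFreeOfRank_extensionBundle m n k, isAlgebraicAction_extensionBundle m n k,
    gluedIso m n k, fun U => ⟨?_, ?_, ?_⟩⟩
  · rw [inl_gluedIso_inv]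
    exact isotypic_extensionBundle m n k .H U
  · rw [inl_inr_gluedIso_inv]
    exact isotypic_extensionBundle m n k .X U
  · rw [inr_inr_gluedIso_inv]
    exact isotypic_extensionBundle m n k .Y U
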